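/- Consider $n\ge 0$ uses of a point-to-point channel with additive-noise feedback. The message $M$ and the feedback noise $V^n=(V_1,\dots,V_n)$ are independent. At each time $i=1,\dots,n$ the transmitter sends $X_i=e_i(M,Y_1+V_1,\dots,Y_{i-1}+V_{i-1})$ for some measurable function $e_i$, that is, the input is determined by the message and the past outputs of the feedback link. The channel then produces $Y_i$ according to a transition probability $p_i(\,\cdot\mid X^i,Y^{i-1})$; that is, given $(M,V^n,X^i,Y^{i-1})$, the conditional law of $Y_i$ is $p_i(\,\cdot\mid X^i,Y^{i-1})$. The transition probabilities and the laws of $M$ and $V^n$ are arbitrary (not necessarily Gaussian). The outputs and the feedback noise take values in $\mathbb{R}$, or more generally in a standard Borel space that is an abelian group with measurable addition; messages and inputs take values in arbitrary measurable spaces. Let $I(\cdot\,;\cdot)$ and $I(\cdot\,;\cdot\mid\cdot)$ denote mutual information and conditional mutual information, with logarithms to base $2$ and values in $[0,\infty]$ (defined as the relative entropy of the joint law with respect to the law under which the two variables are independent, respectively conditionally independent, with the same marginals), and let $$I(X^n\to Y^n)=\sum_{i=1}^n I(X^i;Y_i\mid Y^{i-1}),\qquad I(X^n\to Y^n\mid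 V^n)=\sum_{i=1}^n I(X^i;Y_i\mid Y^{i-1},V^n).$$ Then $$I(M;Y^n)\le I(X^n\to Y^n\mid V^n)\le I(X^n\to Y^n)\le I(X^n;Y^n).$$ If the feedback is ideal ($V^n=0$ almost surely), the first two inequalities are equalities. If there is no feedback (every $X_i$ is almost surely a measurable function of $M$ alone), the last inequality is an equality. -/

import Mathlib

open MeasureTheory ProbabilityTheory
open scoped ENNReal

namespace NoisyFeedback

noncomputable section

/-- The mutual information `I(A; B)` in bits, with values in `[0, ∞]`: the relative entropy of the
joint law of `(A, B)` with respect to the product of the marginal laws.  If the joint law has a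
density `f` with respect to a product of σ-finite measures, this is
`∫ f log₂ (f(a, b) / (f(a) f(b)))`. -/
def mutualInfo {Ω α β : Type*} [MeasurableSpace Ω] [MeasurableSpace α] [MeasurableSpace β]
    (A : Ω → α) (B : Ω → β) (P : Measure Ω) : ℝ≥0∞ :=
  InformationTheory.klDiv (P.map (fun ω => (A ω, B ω))) ((P.map A).prod (P.map B))
    / ENNReal.ofReal (Real.log 2)

/-- The conditional mutual information `I(A; B | C)` in bits, with values in `[0, ∞]`: the relative
entropy of the joint law of `((C, A), B)` with respect to `P_{C,A} ⊗ P_{B|C}`, the law under which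
`(C, A)` and `(C, B)` have the same distributions but `A` and `B` are conditionally independent
given `C`. -/
def condMutualInfo {Ω α β γ : Type*} [MeasurableSpace Ω] [MeasurableSpace α]
    [MeasurableSpace β] [StandardBorelSpace β] [Nonempty β] [MeasurableSpace γ]
    (A : Ω → α) (B : Ω → β) (C : Ω → γ) (P : Measure Ω) [IsFiniteMeasure P] : ℝ≥0∞ :=
  InformationTheory.klDiv (P.map (fun ω => ((C ω, A ω), B ω)))
      ((P.map (fun ω => (C ω, A ω))) ⊗ₘ ((condDistrib B C P).prodMkRight α))
    / ENNReal.ofReal (Real.log 2)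

/-- The initial segment of the sequence `X` up to and including time `i`. -/
def upTo {Ω 𝒳 : Type*} {n : ℕ} (X : Fin n → Ω → 𝒳) (i : Fin n) : Ω → Set.Iic i → 𝒳 :=
  fun ω j => X j ω

/-- The initial segment of the sequence `Y` strictly before time `i`. -/
def before {Ω 𝒴 : Type*} {n : ℕ} (Y : Fin n → Ω → 𝒴) (i : Fin n) : Ω → Set.Iio i → 𝒴 :=
  fun ω j => Y j ω

/-- The whole sequence as one random vector. -/
def block {Ω 𝒴 : Type*} {n : ℕ} (Y : Fin n → Ω → 𝒴) : Ω → Fin n → 𝒴 :=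
  fun ω j => Y j ω

/-- The directed information `I(Xⁿ → Yⁿ) = ∑ᵢ I(Xⁱ; Yᵢ | Yⁱ⁻¹)`. -/
def directedInfo {Ω 𝒳 𝒴 : Type*} [MeasurableSpace Ω] [MeasurableSpace 𝒳]
    [MeasurableSpace 𝒴] [StandardBorelSpace 𝒴] [Nonempty 𝒴] {n : ℕ}
    (X : Fin n → Ω → 𝒳) (Y : Fin n → Ω → 𝒴) (P : Measure Ω) [IsFiniteMeasure P] : ℝ≥0∞ :=
  ∑ i, condMutualInfo (upTo X i) (Y i) (before Y i) P

/-- The conditional directed information `I(Xⁿ → Yⁿ | V) = ∑ᵢ I(Xⁱ; Yᵢ | Yⁱ⁻¹, V)`. -/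
def condDirectedInfo {Ω 𝒳 𝒴 γ : Type*} [MeasurableSpace Ω] [MeasurableSpace 𝒳]
    [MeasurableSpace 𝒴] [StandardBorelSpace 𝒴] [Nonempty 𝒴] [MeasurableSpace γ] {n : ℕ}
    (X : Fin n → Ω → 𝒳) (Y : Fin n → Ω → 𝒴) (V : Ω → γ) (P : Measure Ω) [IsFiniteMeasure P] :
    ℝ≥0∞ :=
  ∑ i, condMutualInfo (upTo X i) (Y i) (fun ω => (before Y i ω, V ω)) P

/-- `n` uses of a point-to-point channel with additive-noise feedback.

* The channel is a family of transition kernels `κ i` (arbitrary, possibly with memory): at time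
  `i` it produces its output at random from the inputs `Xⁱ` and the previous outputs `Yⁱ⁻¹`.
* The feedback link returns `Yⱼ + Vⱼ`, and at time `i` the transmitter has received these values
  for all `j < i`; it computes the input `Xᵢ` from them and the message `M` by means of `enc i`.
* The message and the feedback noise `Vⁿ` come from outside of the channel: they are independent,
  and they act on an output only through the input of the channel. -/
structure IsFeedbackChannel {Ω 𝓜 𝒳 𝒴 : Type*} [MeasurableSpace Ω] [MeasurableSpace 𝓜]
    [MeasurableSpace 𝒳] [MeasurableSpace 𝒴] [AddCommGroup 𝒴] {n : ℕ}
    (κ : ∀ i : Fin n, Kernel ((Set.Iic i → 𝒳) × (Set.Iio i → 𝒴)) 𝒴)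
    (enc : ∀ i : Fin n, 𝓜 × (Set.Iio i → 𝒴) → 𝒳)
    (M : Ω → 𝓜) (X : Fin n → Ω → 𝒳) (Y V : Fin n → Ω → 𝒴) (P : Measure Ω) : Prop where
  measurable_enc : ∀ i, Measurable (enc i)
  measurable_message : Measurable M
  measurable_input : ∀ i, Measurable (X i)
  measurable_output : ∀ i, Measurable (Y i)
  measurable_noise : ∀ i, Measurable (V i)
  message_indep_noise : IndepFun M (block V) P
  input_eq : ∀ i, ∀ᵐ ω ∂P, X i ω = enc i (M ω, before Y i ω + before V i ω)
  output_law : ∀ i, HasCondDistrib (Y i)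
    (fun ω => ((M ω, block V ω), (upTo X i ω, before Y i ω))) ((κ i).prodMkLeft _) P

/-- There is no feedback: every channel input is computed from the message alone. -/
def WithoutFeedback {Ω 𝓜 𝒳 : Type*} [MeasurableSpace Ω] [MeasurableSpace 𝓜] [MeasurableSpace 𝒳]
    {n : ℕ} (M : Ω → 𝓜) (X : Fin n → Ω → 𝒳) (P : Measure Ω) : Prop :=
  ∃ g : Fin n → 𝓜 → 𝒳, (∀ i, Measurable (g i)) ∧ ∀ i, ∀ᵐ ω ∂P, X i ω = g i (M ω)

end

end NoisyFeedback

/-!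
The chain rule splits `I(M; Yⁿ, Vⁿ)` into `I(M; Vⁿ) = 0` and the sum of the `I(M; Yᵢ | Yⁱ⁻¹, Vⁿ)`.
Given `Yⁱ⁻¹` and `Vⁿ`, the inputs `Xⁱ` are a function of `M`, and `M` acts on `Yᵢ` only through
them, so `M` may be replaced by `Xⁱ`: this gives `I(M; Yⁿ, Vⁿ) = I(Xⁿ → Yⁿ | Vⁿ)`. As
`Vⁿ → (Xⁱ, Yⁱ⁻¹) → Yᵢ` is a Markov chain,
`I(Xⁱ; Yᵢ | Yⁱ⁻¹, Vⁿ) ≤ I(Xⁱ, Vⁿ; Yᵢ | Yⁱ⁻¹) = I(Xⁱ; Yᵢ | Yⁱ⁻¹)`. Finally `I(Xⁿ; Yⁿ)` is the sum of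
the `I(Xⁿ; Yᵢ | Yⁱ⁻¹)`, and without feedback the future inputs add nothing to `Xⁱ`.

Messages and inputs live in arbitrary measurable spaces, where regular conditional laws may fail to
exist; the chain rule for conditional mutual information in its first argument therefore rests on a
chain rule for the relative entropy along a map that is phrased with densities.
-/

namespace NoisyFeedback

open InformationTheory

section RelativeEntropy

variable {α β : Type*} {mα : MeasurableSpace α} {mβ : MeasurableSpace β}

lemma klDiv_map_of_leftInverse (μ ν : Measure α) [IsFiniteMeasure μ] [IsFiniteMeasure ν]
    {f : α → β} {g : β → α} (hf : Measurable f) (hg : Measurable g)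
    (hgf : Function.LeftInverse g f) : klDiv (μ.map f) (ν.map f) = klDiv μ ν := by
  refine le_antisymm (klDiv_map_le μ ν hf) ?_
  have h := klDiv_map_le (μ.map f) (ν.map f) hg
  rwa [Measure.map_map hg hf, Measure.map_map hg hf, hgf.comp_eq_id, Measure.map_id,
    Measure.map_id] at h

variable {μ ν : Measure α} {g : α → β} {h : β → ℝ≥0∞}

lemma ae_ne_zero_of_map_eq_withDensity (hg : Measurable g) (hh : Measurable h)
    (hd : μ.map g = (ν.map g).withDensity h) : ∀ᵐ a ∂μ, h (g a) ≠ 0 := by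
  refine ae_of_ae_map (p := fun b ↦ h b ≠ 0) hg.aemeasurable ?_
  rw [hd]
  exact (ae_withDensity_iff hh).2 (ae_of_all _ fun _ hb ↦ hb)

lemma absolutelyContinuous_withDensity_comp_of_map_eq (hμν : μ ≪ ν) (hg : Measurable g)
    (hh : Measurable h) (hd : μ.map g = (ν.map g).withDensity h) : μ ≪ ν.withDensity (h ∘ g) := by
  intro s hs
  have hνs : ∀ᵐ a ∂ν, h (g a) ≠ 0 → a ∉ s :=
    (ae_withDensity_iff (hh.comp hg)).1 (measure_eq_zero_iff_ae_notMem.1 hs)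
  refine measure_eq_zero_iff_ae_notMem.2 ?_
  filter_upwards [hμν.ae_le hνs, ae_ne_zero_of_map_eq_withDensity hg hh hd] with a ha hne
    using ha hne

lemma withDensity_comp_univ_of_map_eq_withDensity (hg : Measurable g) (hh : Measurable h)
    (hd : μ.map g = (ν.map g).withDensity h) : ν.withDensity (h ∘ g) Set.univ = μ Set.univ :=
  calc ν.withDensity (h ∘ g) Set.univ = ∫⁻ a, h (g a) ∂ν := by simp
    _ = ∫⁻ b, h b ∂(ν.map g) := (lintegral_map hh hg).symm
    _ = μ.map g Set.univ := by simp [hd]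
    _ = μ Set.univ := by rw [Measure.map_apply hg .univ, Set.preimage_univ]

lemma llr_ae_eq_llr_map_add_llr_withDensity [IsFiniteMeasure μ] [IsFiniteMeasure ν]
    (hμν : μ ≪ ν) (hg : Measurable g) (hh : Measurable h)
    (hd : μ.map g = (ν.map g).withDensity h) :
    llr μ ν =ᵐ[μ] fun a ↦ llr (μ.map g) (ν.map g) (g a) + llr μ (ν.withDensity (h ∘ g)) a := by
  have hμρ := absolutelyContinuous_withDensity_comp_of_map_eq hμν hg hh hd
  have : IsFiniteMeasure (ν.withDensity (h ∘ g)) :=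
    ⟨by simp [withDensity_comp_univ_of_map_eq_withDensity hg hh hd]⟩
  have h_rnDeriv : (μ.map g).rnDeriv (ν.map g) =ᵐ[ν.map g] h := by
    rw [hd]
    exact Measure.rnDeriv_withDensity _ hh
  have h_map : ∀ᵐ a ∂μ, (μ.map g).rnDeriv (ν.map g) (g a) = h (g a) :=
    hμν.ae_le (ae_of_ae_map hg.aemeasurable h_rnDeriv)
  have h_lt_top : ∀ᵐ a ∂μ, (μ.map g).rnDeriv (ν.map g) (g a) < ∞ :=
    hμν.ae_le (ae_of_ae_map hg.aemeasurable (Measure.rnDeriv_lt_top _ _))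
  filter_upwards [hμν.ae_le (Measure.rnDeriv_mul_rnDeriv hμρ),
    hμν.ae_le (Measure.rnDeriv_withDensity ν (hh.comp hg)), h_map, h_lt_top,
    ae_ne_zero_of_map_eq_withDensity hg hh hd, Measure.rnDeriv_pos hμρ,
    hμρ.ae_le (Measure.rnDeriv_lt_top μ _)] with a hmul hρ hmap hlt hne hpos hlt'
  simp only [Pi.mul_apply, hρ, Function.comp_apply] at hmul
  rw [hmap] at hlt
  simp only [llr, ← hmul, hmap, ENNReal.toReal_mul]
  rw [Real.log_mul (ENNReal.toReal_pos hpos.ne' hlt'.ne).ne'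
    (ENNReal.toReal_pos hne hlt.ne).ne', add_comm]

lemma integrable_llr_iff_of_map_eq_withDensity [IsFiniteMeasure μ] [IsFiniteMeasure ν]
    (hμν : μ ≪ ν) (hg : Measurable g) (hh : Measurable h)
    (hd : μ.map g = (ν.map g).withDensity h) :
    Integrable (llr μ ν) μ ↔
      Integrable (llr (μ.map g) (ν.map g)) (μ.map g) ∧
        Integrable (llr μ (ν.withDensity (h ∘ g))) μ := by
  have h_llr := llr_ae_eq_llr_map_add_llr_withDensity hμν hg hh hd
  refine ⟨fun h_int ↦ ?_, fun ⟨h_map, h_ρ⟩ ↦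
    ((h_map.comp_measurable hg).add h_ρ).congr h_llr.symm⟩
  have h_map := integrable_llr_map hμν hg h_int
  refine ⟨h_map, (h_int.sub (h_map.comp_measurable hg)).congr ?_⟩
  filter_upwards [h_llr] with a ha
  simp [ha]

/-- The chain rule for the relative entropy along `g`: the measure `ν.withDensity (h ∘ g)` has the
image of `μ` under `g` and the conditional laws of `ν` given `g`, but no such conditional laws need
to exist. -/
lemma klDiv_eq_klDiv_map_add_klDiv_withDensity [IsFiniteMeasure μ] [IsFiniteMeasure ν]
    (hg : Measurable g) (hh : Measurable h) (hd : μ.map g = (ν.map g).withDensity h) :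
    klDiv μ ν = klDiv (μ.map g) (ν.map g) + klDiv μ (ν.withDensity (h ∘ g)) := by
  have hρ := withDensity_comp_univ_of_map_eq_withDensity hg hh hd
  have : IsFiniteMeasure (ν.withDensity (h ∘ g)) := ⟨by simp [hρ]⟩
  by_cases hμν : μ ≪ ν
  swap
  · have hμρ : ¬ μ ≪ ν.withDensity (h ∘ g) :=
      fun hac ↦ hμν (hac.trans (withDensity_absolutelyContinuous ν _))
    rw [klDiv_of_not_ac hμν, klDiv_of_not_ac hμρ, add_top]
  have hμρ := absolutelyContinuous_withDensity_comp_of_map_eq hμν hg hh hd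
  have h_iff := integrable_llr_iff_of_map_eq_withDensity hμν hg hh hd
  by_cases h_int : Integrable (llr μ ν) μ
  · obtain ⟨h_map, h_ρ⟩ := h_iff.1 h_int
    have h_comp : Integrable (fun a ↦ llr (μ.map g) (ν.map g) (g a)) μ := h_map.comp_measurable hg
    rw [klDiv_of_ac_of_integrable hμν h_int, klDiv_of_ac_of_integrable (hμν.map hg) h_map,
      klDiv_of_ac_of_integrable hμρ h_ρ, ← ENNReal.ofReal_add
      (integral_llr_add_sub_measure_univ_nonneg (hμν.map hg) h_map)
      (integral_llr_add_sub_measure_univ_nonneg hμρ h_ρ),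
      integral_congr_ae (llr_ae_eq_llr_map_add_llr_withDensity hμν hg hh hd),
      integral_add h_comp h_ρ, integral_map hg.aemeasurable h_map.aestronglyMeasurable,
      measureReal_def (ν.withDensity (h ∘ g)), hρ, ← measureReal_def,
      map_measureReal_apply hg .univ, map_measureReal_apply hg .univ, Set.preimage_univ]
    congr 1
    ring
  · rw [klDiv_of_not_integrable h_int, eq_comm, ENNReal.add_eq_top]
    exact (not_and_or.1 (mt h_iff.2 h_int)).imp klDiv_of_not_integrable klDiv_of_not_integrable

end RelativeEntropy

section CompProd

variable {α β γ : Type*} {mα : MeasurableSpace α} {mβ : MeasurableSpace β}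
  {mγ : MeasurableSpace γ}

lemma map_compProd_comap (μ : Measure α) [SFinite μ] {f : α → γ} (hf : Measurable f)
    (κ : Kernel γ β) [IsSFiniteKernel κ] :
    (μ ⊗ₘ κ.comap f hf).map (Prod.map f id) = μ.map f ⊗ₘ κ := by
  ext s hs
  rw [Measure.map_apply (by fun_prop) hs, Measure.compProd_apply hs,
    Measure.compProd_apply (hs.preimage (by fun_prop)),
    lintegral_map (Kernel.measurable_kernel_prodMk_left hs) hf]
  rfl

lemma klDiv_map_compProd_of_leftInverse (ξ : Measure (α × β)) [IsFiniteMeasure ξ]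
    (μ : Measure α) [IsFiniteMeasure μ] {f : α → γ} {g : γ → α} (hf : Measurable f)
    (hg : Measurable g) (hgf : Function.LeftInverse g f) (κ : Kernel γ β) [IsFiniteKernel κ] :
    klDiv (ξ.map (Prod.map f id)) (μ.map f ⊗ₘ κ) = klDiv ξ (μ ⊗ₘ κ.comap f hf) := by
  rw [← map_compProd_comap μ hf κ]
  exact klDiv_map_of_leftInverse _ _ (hf.prodMap measurable_id) (hg.prodMap measurable_id)
    (hgf.prodMap fun _ ↦ rfl)

lemma compProd_comap_eq_withDensity [MeasurableSpace.CountableOrCountablyGenerated γ β]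
    (μ : Measure α) [SFinite μ] {f : α → γ} (hf : Measurable f) {κ η : Kernel γ β}
    [IsFiniteKernel κ] [IsFiniteKernel η] (hκη : ∀ᵐ c ∂(μ.map f), κ c ≪ η c) :
    μ ⊗ₘ κ.comap f hf = (μ ⊗ₘ η.comap f hf).withDensity
      (Function.uncurry (κ.rnDeriv η) ∘ Prod.map f id) := by
  have hm : Measurable (Function.uncurry fun a ↦ κ.rnDeriv η (f a)) :=
    (κ.measurable_rnDeriv η).comp (hf.prodMap measurable_id)
  have h_comap : (η.comap f hf).withDensity (fun a ↦ κ.rnDeriv η (f a)) =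
      (η.withDensity (κ.rnDeriv η)).comap f hf := by
    ext1 a
    rw [Kernel.withDensity_apply _ hm, Kernel.comap_apply, Kernel.comap_apply,
      Kernel.withDensity_apply η (κ.measurable_rnDeriv η)]
  have : IsSFiniteKernel ((η.comap f hf).withDensity fun a ↦ κ.rnDeriv η (f a)) :=
    h_comap ▸ inferInstance
  have hd : κ.comap f hf =ᵐ[μ] (η.comap f hf).withDensity fun a ↦ κ.rnDeriv η (f a) := by
    filter_upwards [ae_of_ae_map hf.aemeasurable hκη] with a ha
    rw [h_comap, Kernel.comap_apply, Kernel.comap_apply, Kernel.withDensity_rnDeriv_eq ha]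
  exact (Measure.compProd_congr hd).trans (Measure.compProd_withDensity hm)

lemma klDiv_compProd_comap [MeasurableSpace.CountableOrCountablyGenerated γ β]
    (μ : Measure α) [IsFiniteMeasure μ] {f : α → γ} (hf : Measurable f) {κ η : Kernel γ β}
    [IsFiniteKernel κ] [IsFiniteKernel η] {ξ : Measure (α × β)} [IsFiniteMeasure ξ]
    (hξ : ξ.map (Prod.map f id) = μ.map f ⊗ₘ κ) :
    klDiv ξ (μ ⊗ₘ η.comap f hf) =
      klDiv (μ.map f ⊗ₘ κ) (μ.map f ⊗ₘ η) + klDiv ξ (μ ⊗ₘ κ.comap f hf) := by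
  have hg : Measurable (Prod.map f id : α × β → γ × β) := by fun_prop
  have hν : (μ ⊗ₘ η.comap f hf).map (Prod.map f id) = μ.map f ⊗ₘ η := map_compProd_comap μ hf η
  by_cases hκη : ∀ᵐ c ∂(μ.map f), κ c ≪ η c
  · have hd : ξ.map (Prod.map f id) = ((μ ⊗ₘ η.comap f hf).map (Prod.map f id)).withDensity
        (Function.uncurry (κ.rnDeriv η)) := by
      rw [hξ, hν]
      exact compProd_comap_eq_withDensity (μ.map f) measurable_id
        (by rwa [Measure.map_id])
    rw [klDiv_eq_klDiv_map_add_klDiv_withDensity (h := Function.uncurry (κ.rnDeriv η)) hg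
      (κ.measurable_rnDeriv η) hd, hξ, hν,
      ← compProd_comap_eq_withDensity μ hf hκη]
  · have hac : ¬ μ.map f ⊗ₘ κ ≪ μ.map f ⊗ₘ η := fun hac ↦ hκη hac.kernel_of_compProd
    have hac' : ¬ ξ ≪ μ ⊗ₘ η.comap f hf := fun hac' ↦ hac (by rw [← hξ, ← hν]; exact hac'.map hg)
    rw [klDiv_of_not_ac hac, klDiv_of_not_ac hac', top_add]

lemma map_prod_compProd (ρ : Measure α) (σ : Measure γ) [SFinite ρ] [SFinite σ]
    (κ : Kernel γ β) [IsSFiniteKernel κ] :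
    (ρ.prod (σ ⊗ₘ κ)).map (fun p ↦ ((p.2.1, p.1), p.2.2)) = (σ.prod ρ) ⊗ₘ κ.prodMkRight α := by
  refine Measure.ext_of_lintegral _ fun f hf ↦ ?_
  rw [lintegral_map hf (by fun_prop), Measure.lintegral_compProd hf, lintegral_prod _ (by fun_prop),
    lintegral_prod_symm _ (Measurable.lintegral_kernel_prod_right' hf).aemeasurable]
  refine lintegral_congr fun a ↦ ?_
  rw [Measure.lintegral_compProd (by fun_prop)]
  simp only [Kernel.prodMkRight_apply]

end CompProd

section Information

variable {Ω α α' β β' γ γ' δ : Type*} [MeasurableSpace Ω] [MeasurableSpace α] [MeasurableSpace α']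
  [MeasurableSpace β] [MeasurableSpace β'] [MeasurableSpace γ] [MeasurableSpace γ']
  [MeasurableSpace δ] {P : Measure Ω} {A : Ω → α} {B : Ω → β} {C : Ω → γ}

lemma hasCondDistrib_congr_right {C' : Ω → γ} {η : Kernel γ β}
    (h : HasCondDistrib B C η P) (hC : C =ᵐ[P] C') : HasCondDistrib B C' η P where
  aemeasurable := (h.aemeasurable_fst.congr hC).prodMk h.aemeasurable_snd
  map_eq := by
    rw [← Measure.map_congr hC, ← h.map_eq]
    exact Measure.map_congr (hC.symm.mono fun ω hω ↦ by simp [hω])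

variable [IsFiniteMeasure P]

lemma mutualInfo_le_of_ae_eq_comp {B' : Ω → β'} (hA : Measurable A) (hB : Measurable B)
    {f : β → β'} (hf : Measurable f) (h : B' =ᵐ[P] fun ω ↦ f (B ω)) :
    mutualInfo A B' P ≤ mutualInfo A B P := by
  refine ENNReal.div_le_div_right ?_ _
  have h_joint : P.map (fun ω ↦ (A ω, B' ω)) =
      (P.map fun ω ↦ (A ω, B ω)).map (Prod.map id f) := by
    rw [Measure.map_map (by fun_prop) (by fun_prop)]
    exact Measure.map_congr (h.mono fun ω hω ↦ by simp [hω])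
  have h_prod : (P.map A).prod (P.map B') = ((P.map A).prod (P.map B)).map (Prod.map id f) := by
    rw [← Measure.map_prod_map _ _ measurable_id hf, Measure.map_id, Measure.map_map hf hB,
      Measure.map_congr h]
    rfl
  rw [h_joint, h_prod]
  exact klDiv_map_le _ _ (by fun_prop)

lemma mutualInfo_eq_zero_of_indepFun (hA : Measurable A) (hB : Measurable B)
    (h : IndepFun A B P) : mutualInfo A B P = 0 := by
  rw [mutualInfo, (indepFun_iff_map_prod_eq_prod_map_map hA.aemeasurable hB.aemeasurable).1 h,
    klDiv_self, ENNReal.zero_div]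

variable [StandardBorelSpace β] [Nonempty β]

lemma hasCondDistrib_condDistrib (hB : Measurable B) (hC : Measurable C) :
    HasCondDistrib B C (condDistrib B C P) P :=
  ⟨by fun_prop, (compProd_map_condDistrib hB.aemeasurable).symm⟩

lemma condMutualInfo_eq_klDiv_of_hasCondDistrib (hA : Measurable A) (hC : Measurable C)
    {η : Kernel γ β} [IsFiniteKernel η] (h : HasCondDistrib B C η P) :
    condMutualInfo A B C P = klDiv (P.map fun ω ↦ ((C ω, A ω), B ω))
      ((P.map fun ω ↦ (C ω, A ω)) ⊗ₘ η.prodMkRight α) / ENNReal.ofReal (Real.log 2) := by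
  have h_ae : condDistrib B C P =ᵐ[(P.map fun ω ↦ (C ω, A ω)).map Prod.fst] η := by
    rw [Measure.map_map measurable_fst (by fun_prop)]
    exact condDistrib_ae_eq_of_measure_eq_compProd C h.aemeasurable_snd h.map_eq
  have h_ae' : (condDistrib B C P).prodMkRight α =ᵐ[P.map fun ω ↦ (C ω, A ω)] η.prodMkRight α :=
    ae_of_ae_map measurable_fst.aemeasurable h_ae
  rw [condMutualInfo, Measure.compProd_congr h_ae']

lemma condMutualInfo_congr_ae {A' : Ω → α} {C' : Ω → γ} (hA : A =ᵐ[P] A') (hC : C =ᵐ[P] C') :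
    condMutualInfo A B C P = condMutualInfo A' B C' P := by
  have h_pair : (fun ω ↦ (C ω, A ω)) =ᵐ[P] fun ω ↦ (C' ω, A' ω) := hC.prodMk hA
  rw [condMutualInfo, condMutualInfo, Measure.map_congr h_pair, condDistrib_congr_right hC,
    Measure.map_congr (h_pair.prodMk (.refl _ B))]

lemma condMutualInfo_comp_cond_of_leftInverse (hA : Measurable A) (hB : Measurable B)
    (hC : Measurable C) {f : γ → γ'} {g : γ' → γ} (hf : Measurable f) (hg : Measurable g)
    (hgf : Function.LeftInverse g f) :
    condMutualInfo A B (fun ω ↦ f (C ω)) P = condMutualInfo A B C P := by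
  let η := (condDistrib B C P).comap g hg
  have hη : η.comap f hf = condDistrib B C P := by
    ext1 c
    simp only [η, Kernel.comap_apply, hgf c]
  have h_cond : HasCondDistrib B (fun ω ↦ f (C ω)) η P :=
    HasCondDistrib.comp_right (hf := hf) (by rw [hη]; exact hasCondDistrib_condDistrib hB hC)
  have h_kl := klDiv_map_compProd_of_leftInverse (P.map fun ω ↦ ((C ω, A ω), B ω))
    (P.map fun ω ↦ (C ω, A ω)) (hf.prodMap measurable_id) (hg.prodMap measurable_id)
    (hgf.prodMap fun _ : α ↦ rfl) (η.prodMkRight α)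
  rw [Measure.map_map (by fun_prop) (by fun_prop), Measure.map_map (by fun_prop) (by fun_prop)]
    at h_kl
  rw [condMutualInfo_eq_klDiv_of_hasCondDistrib hA (by fun_prop) h_cond, condMutualInfo, ← hη]
  exact congrArg (· / _) h_kl

lemma condMutualInfo_le_of_ae_eq_comp (hA : Measurable A) (hB : Measurable B) (hC : Measurable C)
    {A' : Ω → α'} {f : γ × α → α'} (hf : Measurable f) (h : A' =ᵐ[P] fun ω ↦ f (C ω, A ω)) :
    condMutualInfo A' B C P ≤ condMutualInfo A B C P := by
  let g : γ × α → γ × α' := fun p ↦ (p.1, f p)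
  have hg : Measurable g := by fun_prop
  have h_le := klDiv_map_le (P.map fun ω ↦ ((C ω, A ω), B ω))
    ((P.map fun ω ↦ (C ω, A ω)) ⊗ₘ ((condDistrib B C P).prodMkRight α').comap g hg)
    (hg.prodMap measurable_id)
  rw [map_compProd_comap, Measure.map_map (by fun_prop) (by fun_prop),
    Measure.map_map (by fun_prop) (by fun_prop)] at h_le
  rw [condMutualInfo_congr_ae h (.refl _ C)]
  exact ENNReal.div_le_div_right h_le _

lemma condMutualInfo_prodMk_eq_add {D : Ω → δ} (hA : Measurable A) (hB : Measurable B)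
    (hC : Measurable C) (hD : Measurable D) :
    condMutualInfo (fun ω ↦ (D ω, A ω)) B C P =
      condMutualInfo D B C P + condMutualInfo A B (fun ω ↦ (C ω, D ω)) P := by
  let η := condDistrib B C P
  let κ := condDistrib B (fun ω ↦ (C ω, D ω)) P
  let ξ := P.map fun ω ↦ ((C ω, D ω, A ω), B ω)
  let μ := P.map fun ω ↦ (C ω, D ω, A ω)
  let f : γ × δ × α → γ × δ := fun p ↦ (p.1, p.2.1)
  have hf : Measurable f := by fun_prop
  have hμ : μ.map f = P.map fun ω ↦ (C ω, D ω) := Measure.map_map hf (by fun_prop)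
  have hξ : ξ.map (Prod.map f id) = μ.map f ⊗ₘ κ := by
    rw [hμ, compProd_map_condDistrib hB.aemeasurable]
    exact Measure.map_map (by fun_prop) (by fun_prop)
  have h_chain := klDiv_compProd_comap μ hf (η := η.prodMkRight δ) hξ
  have h_assoc := klDiv_map_compProd_of_leftInverse ξ μ MeasurableEquiv.prodAssoc.symm.measurable
    MeasurableEquiv.prodAssoc.measurable MeasurableEquiv.prodAssoc.right_inv (κ.prodMkRight α)
  rw [Measure.map_map (by fun_prop) (by fun_prop), Measure.map_map (by fun_prop) (by fun_prop)]
    at h_assoc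
  rw [hμ, compProd_map_condDistrib hB.aemeasurable] at h_chain
  rw [condMutualInfo, condMutualInfo, condMutualInfo, ← ENNReal.add_div]
  exact congrArg (· / _) (h_chain.trans (congrArg (_ + ·) h_assoc.symm))

lemma condMutualInfo_eq_zero_of_hasCondDistrib (hA : Measurable A) (hC : Measurable C)
    {η : Kernel γ β} [IsFiniteKernel η]
    (h : HasCondDistrib B (fun ω ↦ (C ω, A ω)) (η.prodMkRight α) P) :
    condMutualInfo A B C P = 0 := by
  have h_cond : HasCondDistrib B C η P :=
    HasCondDistrib.comp_right (f := Prod.fst) (hf := measurable_fst) h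
  rw [condMutualInfo_eq_klDiv_of_hasCondDistrib hA hC h_cond, h.map_eq, klDiv_self,
    ENNReal.zero_div]

lemma condMutualInfo_eq_of_ae_eq_comp_of_hasCondDistrib {D : Ω → δ} (hA : Measurable A)
    (hB : Measurable B) (hC : Measurable C) (hD : Measurable D) {f : γ × α → δ} (hf : Measurable f)
    (hDA : D =ᵐ[P] fun ω ↦ f (C ω, A ω)) {η : Kernel (γ × δ) β} [IsFiniteKernel η]
    (h : HasCondDistrib B (fun ω ↦ ((C ω, D ω), A ω)) (η.prodMkRight α) P) :
    condMutualInfo A B C P = condMutualInfo D B C P := by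
  refine le_antisymm ?_ (condMutualInfo_le_of_ae_eq_comp hA hB hC hf hDA)
  calc condMutualInfo A B C P ≤ condMutualInfo (fun ω ↦ (D ω, A ω)) B C P :=
        condMutualInfo_le_of_ae_eq_comp (hD.prodMk hA) hB hC (f := fun p ↦ p.2.2) (by fun_prop)
          (.refl _ _)
    _ = condMutualInfo D B C P := by
        rw [condMutualInfo_prodMk_eq_add hA hB hC hD,
          condMutualInfo_eq_zero_of_hasCondDistrib hA (hC.prodMk hD) h, add_zero]

lemma condMutualInfo_prodMk_cond_le {D : Ω → δ} (hA : Measurable A) (hB : Measurable B)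
    (hC : Measurable C) (hD : Measurable D) {η : Kernel (γ × α) β} [IsFiniteKernel η]
    (h : HasCondDistrib B (fun ω ↦ ((C ω, A ω), D ω)) (η.prodMkRight δ) P) :
    condMutualInfo A B (fun ω ↦ (C ω, D ω)) P ≤ condMutualInfo A B C P :=
  calc condMutualInfo A B (fun ω ↦ (C ω, D ω)) P
      ≤ condMutualInfo D B C P + condMutualInfo A B (fun ω ↦ (C ω, D ω)) P := le_add_self
    _ = condMutualInfo (fun ω ↦ (D ω, A ω)) B C P := (condMutualInfo_prodMk_eq_add hA hB hC hD).symm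
    _ ≤ condMutualInfo (fun ω ↦ (A ω, D ω)) B C P :=
        condMutualInfo_le_of_ae_eq_comp (hA.prodMk hD) hB hC (f := fun p ↦ p.2.swap) (by fun_prop)
          (.refl _ _)
    _ = condMutualInfo A B C P := by
        rw [condMutualInfo_prodMk_eq_add hD hB hC hA,
          condMutualInfo_eq_zero_of_hasCondDistrib hD (hC.prodMk hA) h, add_zero]

lemma mutualInfo_prodMk_eq_add (hA : Measurable A) (hB : Measurable B) (hC : Measurable C) :
    mutualInfo A (fun ω ↦ (C ω, B ω)) P = mutualInfo A C P + condMutualInfo A B C P := by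
  have h_prod : (((P.map A).prod (P.map fun ω ↦ (C ω, B ω))).map
      fun p ↦ ((p.2.1, p.1), p.2.2)) =
      ((P.map C).prod (P.map A)) ⊗ₘ (condDistrib B C P).prodMkRight α := by
    rw [← compProd_map_condDistrib hB.aemeasurable, map_prod_compProd]
  have h_joint : ((P.map fun ω ↦ (A ω, C ω, B ω)).map fun p ↦ ((p.2.1, p.1), p.2.2)) =
      (P.map fun ω ↦ (C ω, A ω)) ⊗ₘ condDistrib B (fun ω ↦ (C ω, A ω)) P := by
    rw [Measure.map_map (by fun_prop) (by fun_prop), compProd_map_condDistrib hB.aemeasurable]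
    rfl
  have h_swap : klDiv (P.map fun ω ↦ (C ω, A ω)) ((P.map C).prod (P.map A)) =
      klDiv (P.map fun ω ↦ (A ω, C ω)) ((P.map A).prod (P.map C)) := by
    rw [← klDiv_map_of_leftInverse _ _ measurable_swap measurable_swap Prod.swap_swap,
      Measure.map_map measurable_swap (by fun_prop), Measure.prod_swap]
    rfl
  rw [mutualInfo, mutualInfo, condMutualInfo, ← ENNReal.add_div,
    ← klDiv_map_of_leftInverse (f := fun p : α × γ × β ↦ ((p.2.1, p.1), p.2.2))
      (g := fun p ↦ (p.1.2, p.1.1, p.2)) _ _ (by fun_prop) (by fun_prop) fun _ ↦ rfl,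
    h_joint, h_prod, klDiv_compProd_eq_add, h_swap, compProd_map_condDistrib hB.aemeasurable]

end Information

section Sequences

variable {Ω α 𝒳 𝒴 γ : Type*} [MeasurableSpace Ω] [MeasurableSpace α] [MeasurableSpace 𝒳]
  [MeasurableSpace 𝒴] [MeasurableSpace γ] {n : ℕ}

@[fun_prop]
lemma measurable_block {Y : Fin n → Ω → 𝒴} (hY : ∀ i, Measurable (Y i)) :
    Measurable (block Y) := measurable_pi_lambda _ hY

@[fun_prop]
lemma measurable_before {Y : Fin n → Ω → 𝒴} (hY : ∀ i, Measurable (Y i)) (i : Fin n) :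
    Measurable (before Y i) := measurable_pi_lambda _ fun j ↦ hY j

@[fun_prop]
lemma measurable_upTo {X : Fin n → Ω → 𝒳} (hX : ∀ i, Measurable (X i)) (i : Fin n) :
    Measurable (upTo X i) := measurable_pi_lambda _ fun j ↦ hX j

variable {P : Measure Ω} [IsFiniteMeasure P] {A : Ω → α} {C : Ω → γ}

lemma mutualInfo_block_succ_prodMk (hA : Measurable A) (hC : Measurable C)
    {Y : Fin (n + 1) → Ω → 𝒴} (hY : ∀ i, Measurable (Y i)) :
    mutualInfo A (fun ω ↦ (block Y ω, C ω)) P =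
      mutualInfo A (fun ω ↦ ((block (fun i : Fin n ↦ Y i.castSucc) ω, C ω), Y (Fin.last n) ω))
        P := by
  have hY' : ∀ i : Fin n, Measurable (Y i.castSucc) := fun i ↦ hY _
  refine le_antisymm (mutualInfo_le_of_ae_eq_comp hA (by fun_prop)
    (f := fun p ↦ (Fin.snoc (α := fun _ ↦ 𝒴) p.1.1 p.2, p.1.2)) ?_ (.of_forall fun ω ↦ ?_))
    (mutualInfo_le_of_ae_eq_comp hA (by fun_prop)
      (f := fun p ↦ ((fun i ↦ p.1 i.castSucc, p.2), p.1 (Fin.last n))) (by fun_prop) (.refl _ _))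
  · refine Measurable.prodMk (measurable_pi_lambda _ (Fin.lastCases ?_ fun i ↦ ?_)) (by fun_prop)
    · simp only [Fin.snoc_last]
      fun_prop
    · simp only [Fin.snoc_castSucc]
      fun_prop
  · exact Prod.ext (Fin.snoc_init_self (block Y ω)).symm rfl

variable [StandardBorelSpace 𝒴] [Nonempty 𝒴]

lemma condMutualInfo_before_castSucc (hA : Measurable A) (hC : Measurable C)
    {Y : Fin (n + 1) → Ω → 𝒴} (hY : ∀ i, Measurable (Y i)) (i : Fin n) :
    condMutualInfo A (Y i.castSucc) (fun ω ↦ (before Y i.castSucc ω, C ω)) P =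
      condMutualInfo A (Y i.castSucc) (fun ω ↦ (before (fun j : Fin n ↦ Y j.castSucc) i ω, C ω))
        P :=
  condMutualInfo_comp_cond_of_leftInverse hA (hY i.castSucc)
    ((measurable_before (fun j : Fin n ↦ hY j.castSucc) i).prodMk hC)
    (f := fun p ↦ (fun j : Set.Iio i.castSucc ↦
      p.1 ⟨j.1.castPred (lt_trans j.2 (Fin.castSucc_lt_last i)).ne, j.2⟩, p.2))
    (g := fun p ↦ (fun j : Set.Iio i ↦
      p.1 ⟨j.1.castSucc, Fin.castSucc_lt_castSucc_iff.2 j.2⟩, p.2))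
    (by fun_prop) (by fun_prop) fun _ ↦ rfl

lemma condMutualInfo_before_last (hA : Measurable A) (hC : Measurable C)
    {Y : Fin (n + 1) → Ω → 𝒴} (hY : ∀ i, Measurable (Y i)) :
    condMutualInfo A (Y (Fin.last n)) (fun ω ↦ (before Y (Fin.last n) ω, C ω)) P =
      condMutualInfo A (Y (Fin.last n))
        (fun ω ↦ (block (fun j : Fin n ↦ Y j.castSucc) ω, C ω)) P :=
  condMutualInfo_comp_cond_of_leftInverse hA (hY (Fin.last n))
    ((measurable_block fun j : Fin n ↦ hY j.castSucc).prodMk hC)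
    (f := fun p ↦ (fun j : Set.Iio (Fin.last n) ↦ p.1 (j.1.castPred (ne_of_lt j.2)), p.2))
    (g := fun p ↦ (fun j ↦ p.1 ⟨j.castSucc, Fin.castSucc_lt_last j⟩, p.2))
    (by fun_prop) (by fun_prop) fun _ ↦ rfl

lemma mutualInfo_block_prodMk_eq_add_sum (hA : Measurable A) (hC : Measurable C)
    {Y : Fin n → Ω → 𝒴} (hY : ∀ i, Measurable (Y i)) :
    mutualInfo A (fun ω ↦ (block Y ω, C ω)) P =
      mutualInfo A C P + ∑ i, condMutualInfo A (Y i) (fun ω ↦ (before Y i ω, C ω)) P := by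
  induction n with
  | zero =>
    rw [Finset.univ_eq_empty, Finset.sum_empty, add_zero]
    exact le_antisymm
      (mutualInfo_le_of_ae_eq_comp hA hC (f := fun c ↦ (Fin.elim0, c)) (by fun_prop)
        (.of_forall fun ω ↦ Prod.ext (Subsingleton.elim _ _) rfl))
      (mutualInfo_le_of_ae_eq_comp hA (by fun_prop) measurable_snd (.refl _ _))
  | succ n ih =>
    have hY' : ∀ i : Fin n, Measurable (Y i.castSucc) := fun i ↦ hY _
    rw [mutualInfo_block_succ_prodMk hA hC hY,
      mutualInfo_prodMk_eq_add hA (hY _) (by fun_prop), ih hY', Fin.sum_univ_castSucc,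
      add_assoc, condMutualInfo_before_last hA hC hY]
    simp only [condMutualInfo_before_castSucc hA hC hY]

lemma mutualInfo_block_eq_sum {P : Measure Ω} [IsProbabilityMeasure P] (hA : Measurable A)
    {Y : Fin n → Ω → 𝒴} (hY : ∀ i, Measurable (Y i)) :
    mutualInfo A (block Y) P = ∑ i, condMutualInfo A (Y i) (before Y i) P :=
  calc mutualInfo A (block Y) P = mutualInfo A (fun ω ↦ (block Y ω, ())) P :=
        le_antisymm (mutualInfo_le_of_ae_eq_comp hA (by fun_prop) measurable_fst (.refl _ _))
          (mutualInfo_le_of_ae_eq_comp hA (by fun_prop) (f := fun y ↦ (y, ())) (by fun_prop)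
            (.refl _ _))
    _ = ∑ i, condMutualInfo A (Y i) (fun ω ↦ (before Y i ω, ())) P := by
        rw [mutualInfo_block_prodMk_eq_add_sum hA measurable_const hY,
          mutualInfo_eq_zero_of_indepFun hA measurable_const (indepFun_const_right A ()), zero_add]
    _ = ∑ i, condMutualInfo A (Y i) (before Y i) P :=
        Finset.sum_congr rfl fun i _ ↦ condMutualInfo_comp_cond_of_leftInverse hA (hY i)
          (by fun_prop) (f := fun y ↦ (y, ())) (g := Prod.fst) (by fun_prop) (by fun_prop)
          fun _ ↦ rfl

variable {X : Fin n → Ω → 𝒳} {Y : Fin n → Ω → 𝒴}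

lemma directedInfo_le_mutualInfo {P : Measure Ω} [IsProbabilityMeasure P]
    (hX : ∀ i, Measurable (X i)) (hY : ∀ i, Measurable (Y i)) :
    directedInfo X Y P ≤ mutualInfo (block X) (block Y) P := by
  rw [mutualInfo_block_eq_sum (measurable_block hX) hY]
  exact Finset.sum_le_sum fun i _ ↦ condMutualInfo_le_of_ae_eq_comp (measurable_block hX) (hY i)
    (by fun_prop) (f := fun p j ↦ p.2 j) (by fun_prop) (.refl _ _)

lemma condDirectedInfo_eq_directedInfo_of_ae_eq_const (hX : ∀ i, Measurable (X i))
    (hY : ∀ i, Measurable (Y i)) {c : γ} (hC : C =ᵐ[P] fun _ ↦ c) :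
    condDirectedInfo X Y C P = directedInfo X Y P := by
  refine Finset.sum_congr rfl fun i _ ↦ ?_
  rw [condMutualInfo_congr_ae (.refl _ (upTo X i))
    ((Filter.EventuallyEq.refl _ (before Y i)).prodMk hC)]
  exact condMutualInfo_comp_cond_of_leftInverse (by fun_prop) (hY i) (by fun_prop)
    (f := fun y ↦ (y, c)) (g := Prod.fst) (by fun_prop) (by fun_prop) fun _ ↦ rfl

end Sequences

namespace IsFeedbackChannel

variable {Ω 𝓜 𝒳 𝒴 : Type*} [MeasurableSpace Ω] [MeasurableSpace 𝓜] [MeasurableSpace 𝒳]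
  [MeasurableSpace 𝒴] [AddCommGroup 𝒴] {P : Measure Ω} {n : ℕ}
  {κ : ∀ i : Fin n, Kernel ((Set.Iic i → 𝒳) × (Set.Iio i → 𝒴)) 𝒴}
  {enc : ∀ i : Fin n, 𝓜 × (Set.Iio i → 𝒴) → 𝒳}
  {M : Ω → 𝓜} {X : Fin n → Ω → 𝒳} {Y V : Fin n → Ω → 𝒴}

lemma exists_measurable_upTo_input_eq [MeasurableAdd₂ 𝒴]
    (h : IsFeedbackChannel κ enc M X Y V P) (i : Fin n) :
    ∃ f : ((Set.Iio i → 𝒴) × (Fin n → 𝒴)) × 𝓜 → Set.Iic i → 𝒳, Measurable f ∧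
      upTo X i =ᵐ[P] fun ω ↦ f ((before Y i ω, block V ω), M ω) := by
  have henc := h.measurable_enc
  refine ⟨fun p j ↦ enc j (p.2, fun k ↦ p.1.1 ⟨k, (Set.mem_Iio.1 k.2).trans_le j.2⟩ + p.1.2 k),
    by fun_prop, ?_⟩
  filter_upwards [ae_all_iff.2 h.input_eq] with ω hω using funext fun j ↦ hω j

lemma hasCondDistrib_output [SFinite P] (h : IsFeedbackChannel κ enc M X Y V P) (i : Fin n)
    {δ : Type*} [MeasurableSpace δ]
    {f : (𝓜 × (Fin n → 𝒴)) × (Set.Iic i → 𝒳) × (Set.Iio i → 𝒴) → δ} (hf : Measurable f)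
    {η : Kernel δ 𝒴} [IsSFiniteKernel η] (hη : η.comap f hf = (κ i).prodMkLeft _) :
    HasCondDistrib (Y i) (fun ω ↦ f ((M ω, block V ω), (upTo X i ω, before Y i ω))) η P :=
  HasCondDistrib.comp_right (hf := hf) (hη ▸ h.output_law i)

variable [StandardBorelSpace 𝒴] [IsFiniteMeasure P] [∀ i, IsFiniteKernel (κ i)]

lemma condMutualInfo_message_eq_condMutualInfo_upTo [MeasurableAdd₂ 𝒴]
    (h : IsFeedbackChannel κ enc M X Y V P) (i : Fin n) :
    condMutualInfo M (Y i) (fun ω ↦ (before Y i ω, block V ω)) P =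
      condMutualInfo (upTo X i) (Y i) (fun ω ↦ (before Y i ω, block V ω)) P := by
  have hX := measurable_upTo h.measurable_input i
  have hY := measurable_before h.measurable_output i
  have hV := measurable_block h.measurable_noise
  obtain ⟨f, hf, hfX⟩ := h.exists_measurable_upTo_input_eq i
  exact condMutualInfo_eq_of_ae_eq_comp_of_hasCondDistrib h.measurable_message
    (h.measurable_output i) (hY.prodMk hV) hX hf hfX
    (η := (κ i).comap (fun p ↦ (p.2, p.1.1)) (by fun_prop))
    (h.hasCondDistrib_output i (f := fun p ↦ (((p.2.2, p.1.2), p.2.1), p.1.1)) (by fun_prop) rfl)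

lemma mutualInfo_message_output_noise_eq_condDirectedInfo [MeasurableAdd₂ 𝒴]
    (h : IsFeedbackChannel κ enc M X Y V P) :
    mutualInfo M (fun ω ↦ (block Y ω, block V ω)) P = condDirectedInfo X Y (block V) P := by
  have hV := measurable_block h.measurable_noise
  rw [mutualInfo_block_prodMk_eq_add_sum h.measurable_message hV h.measurable_output,
    mutualInfo_eq_zero_of_indepFun h.measurable_message hV h.message_indep_noise, zero_add]
  exact Finset.sum_congr rfl fun i _ ↦ h.condMutualInfo_message_eq_condMutualInfo_upTo i

lemma mutualInfo_message_le_condDirectedInfo [MeasurableAdd₂ 𝒴]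
    (h : IsFeedbackChannel κ enc M X Y V P) :
    mutualInfo M (block Y) P ≤ condDirectedInfo X Y (block V) P := by
  have hY := measurable_block h.measurable_output
  have hV := measurable_block h.measurable_noise
  rw [← h.mutualInfo_message_output_noise_eq_condDirectedInfo]
  exact mutualInfo_le_of_ae_eq_comp h.measurable_message (by fun_prop) measurable_fst (.refl _ _)

lemma condDirectedInfo_le_mutualInfo_message_of_noise_ae_eq_const [MeasurableAdd₂ 𝒴]
    (h : IsFeedbackChannel κ enc M X Y V P) {v : Fin n → 𝒴} (hv : block V =ᵐ[P] fun _ ↦ v) :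
    condDirectedInfo X Y (block V) P ≤ mutualInfo M (block Y) P := by
  rw [← h.mutualInfo_message_output_noise_eq_condDirectedInfo]
  exact mutualInfo_le_of_ae_eq_comp h.measurable_message (measurable_block h.measurable_output)
    (f := fun y ↦ (y, v)) (by fun_prop) ((Filter.EventuallyEq.refl _ (block Y)).prodMk hv)

lemma condDirectedInfo_le_directedInfo (h : IsFeedbackChannel κ enc M X Y V P) :
    condDirectedInfo X Y (block V) P ≤ directedInfo X Y P :=
  Finset.sum_le_sum fun i _ ↦ condMutualInfo_prodMk_cond_le
    (measurable_upTo h.measurable_input i) (h.measurable_output i)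
    (measurable_before h.measurable_output i) (measurable_block h.measurable_noise)
    (η := (κ i).comap Prod.swap measurable_swap)
    (h.hasCondDistrib_output i (f := fun p ↦ ((p.2.2, p.2.1), p.1.2)) (by fun_prop) rfl)

lemma condMutualInfo_block_eq_condMutualInfo_upTo (h : IsFeedbackChannel κ enc M X Y V P)
    (hX : WithoutFeedback M X P) (i : Fin n) :
    condMutualInfo (block X) (Y i) (before Y i) P =
      condMutualInfo (upTo X i) (Y i) (before Y i) P := by
  obtain ⟨g, hg, hgX⟩ := hX
  have h_block : (fun ω j ↦ g j (M ω)) =ᵐ[P] block X := by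
    filter_upwards [ae_all_iff.2 hgX] with ω hω using (funext hω).symm
  refine condMutualInfo_eq_of_ae_eq_comp_of_hasCondDistrib (measurable_block h.measurable_input)
    (h.measurable_output i) (measurable_before h.measurable_output i)
    (measurable_upTo h.measurable_input i) (f := fun p j ↦ p.2 j) (by fun_prop) (.refl _ _)
    (η := (κ i).comap Prod.swap measurable_swap) ?_
  exact hasCondDistrib_congr_right
    (h.hasCondDistrib_output i (f := fun p ↦ ((p.2.2, p.2.1), fun j ↦ g j p.1.1)) (by fun_prop)
      rfl)
    ((Filter.EventuallyEq.refl _ fun ω ↦ (before Y i ω, upTo X i ω)).prodMk h_block)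

lemma directedInfo_eq_mutualInfo {P : Measure Ω} [IsProbabilityMeasure P]
    (h : IsFeedbackChannel κ enc M X Y V P) (hX : WithoutFeedback M X P) :
    directedInfo X Y P = mutualInfo (block X) (block Y) P := by
  rw [mutualInfo_block_eq_sum (measurable_block h.measurable_input) h.measurable_output]
  exact Finset.sum_congr rfl fun i _ ↦ (h.condMutualInfo_block_eq_condMutualInfo_upTo hX i).symm

end IsFeedbackChannel

end NoisyFeedback

theorem lemma2 {Ω 𝓜 𝒳 𝒴 : Type*} [MeasurableSpace Ω] [MeasurableSpace 𝓜] [MeasurableSpace 𝒳]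
    [MeasurableSpace 𝒴] [StandardBorelSpace 𝒴] [AddCommGroup 𝒴] [MeasurableAdd₂ 𝒴]
    (P : Measure Ω) [IsProbabilityMeasure P] (n : ℕ)
    (κ : ∀ i : Fin n, Kernel ((Set.Iic i → 𝒳) × (Set.Iio i → 𝒴)) 𝒴) [∀ i, IsMarkovKernel (κ i)]
    (enc : ∀ i : Fin n, 𝓜 × (Set.Iio i → 𝒴) → 𝒳)
    (M : Ω → 𝓜) (X : Fin n → Ω → 𝒳) (Y V : Fin n → Ω → 𝒴)
    (h : NoisyFeedback.IsFeedbackChannel κ enc M X Y V P) :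
    (NoisyFeedback.mutualInfo M (NoisyFeedback.block Y) P
        ≤ NoisyFeedback.condDirectedInfo X Y (NoisyFeedback.block V) P ∧
      NoisyFeedback.condDirectedInfo X Y (NoisyFeedback.block V) P
        ≤ NoisyFeedback.directedInfo X Y P ∧
      NoisyFeedback.directedInfo X Y P
        ≤ NoisyFeedback.mutualInfo (NoisyFeedback.block X) (NoisyFeedback.block Y) P) ∧
    ((∀ i, ∀ᵐ ω ∂P, V i ω = 0) →
      NoisyFeedback.mutualInfo M (NoisyFeedback.block Y) P
        = NoisyFeedback.condDirectedInfo X Y (NoisyFeedback.block V) P ∧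
      NoisyFeedback.condDirectedInfo X Y (NoisyFeedback.block V) P
        = NoisyFeedback.directedInfo X Y P) ∧
    (NoisyFeedback.WithoutFeedback M X P →
      NoisyFeedback.directedInfo X Y P
        = NoisyFeedback.mutualInfo (NoisyFeedback.block X) (NoisyFeedback.block Y) P) := by
  open NoisyFeedback in
  refine ⟨⟨h.mutualInfo_message_le_condDirectedInfo, h.condDirectedInfo_le_directedInfo,
    directedInfo_le_mutualInfo h.measurable_input h.measurable_output⟩, fun hV ↦ ?_,
    h.directedInfo_eq_mutualInfo⟩
  have hV_zero : block V =ᵐ[P] fun _ ↦ 0 := by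
    filter_upwards [ae_all_iff.2 hV] with ω hω using funext hω
  exact ⟨h.mutualInfo_message_le_condDirectedInfo.antisymm
      (h.condDirectedInfo_le_mutualInfo_message_of_noise_ae_eq_const hV_zero),
    condDirectedInfo_eq_directedInfo_of_ae_eq_const h.measurable_input h.measurable_output hV_zero⟩
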